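/- Let $\mathbf k$ be a field, let $G$ be an abelian group, and let $x_1,x_2$ be quantum variables: with $x_i$ are associated an element $g_i\in G$ and a character $\chi^i:G\to\mathbf k^{*}$ $(i=1,2)$. Put $p_{ij}=\chi^i(g_j)$ and $q=p_{22}$, and assume $$p_{11}=p_{12}^{-1}p_{21}^{-1}=p_{22}^3\neq 1,\qquad p_{22}\neq -1 .$$ Let $G\langle x_1,x_2\rangle$ be the skew group algebra generated by $G$ and $\mathbf k\langle x_1,x_2\rangle$ with the commutation rules $x_ig=\chi^i(g)\,g\,x_i$ $(g\in G)$ and with the coproduct $\Delta(g)=g\otimes g$, $\Delta(x_i)=x_i\otimes 1+g_i\otimes x_i$. For homogeneous $u,v$ the skew bracket is $[u,v]=uv-\chi^u(g_v)\,vu$, where $g_u\in G$ and $\chi^u$ are obtained from $u$ by replacing each $x_i$ with $g_i$, respectively with $\chi^i$. For $i\ne j$ put $$[x_ix_j^m]=[\ldots[[x_i,x_j],x_j],\ldots,x_j],\qquad [x_j^mx_i]=[x_j,[x_j,\ldots,[x_j,x_i]\ldots]]$$ ($m$ letters $x_j$; both are $x_i$ if $m=0$). Let $U_q^+(\mathfrak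 g)$, $\mathfrak g$ of type $G_2$, be the quotient of $G\langle x_1,x_2\rangle$ by the quantum Serre relations $[x_1x_2^4]=0$ and $[x_1^2x_2]=0$; the coproduct $\Delta$ descends to it. Put $[n]_q=1+q+\cdots+q^{n-1}$, $[n]_q!=\prod_{k=1}^n[k]_q$ and, for $0\le n\le 3$, in $U_q^+(\mathfrak g)$, $$\{x_1x_2^n\}=\frac{[x_1x_2^n]}{[n]_q!\prod_{s=0}^{n-1}(1-p_{12}p_{21}q^s)},\qquad \{x_2^nx_1\}=\frac{[x_2^nx_1]}{[n]_q!\prod_{s=0}^{n-1}(1-p_{12}p_{21}q^s)}$$ (the denominators are nonzero). Define $$\{x_1x_2^3x_1\}=-p_{21}^2\,\frac{q^3+q^2}{1-q^3}\,\{x_1x_2\}\{x_1x_2^2\}+p_{21}\,\frac{[4]_q-2}{1-q^3}\,\{x_1x_2^2\}\{x_1x_2\}+\{x_1x_2^3\}\,x_1 .$$ **Theorem.** In $U_q^+(\mathfrak g)\otimes U_q^+(\mathfrak g)$, $$\Delta(\{x_1x_2^3x_1\})=\{x_1x_2^3x_1\}\otimes 1+g_1^2g_2^3\otimes\{x_1x_2^3x_1\}+\sum_{k=0}^3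 g_1g_2^k\,\{x_2^{3-k}x_1\}\otimes\{x_1x_2^k\}.$$ -/

import Mathlib

open scoped TensorProduct

namespace QuantumBorel

/-- A family of quantum variables `x_i`, `i ∈ ι`: with each of them are associated an element `g_i`
of an abelian group `G` and a character `χ^i : G → kˣ`. -/
structure QuantumVariables (k G ι : Type*) [Field k] [CommGroup G] where
  gr : ι → G
  chr : ι → G →* kˣ

section Skew

variable {k G ι : Type*} [Field k] [CommGroup G] (Q : QuantumVariables k G ι)

/-- The quantization parameters `p_ij = χ^i(g_j)`. -/
def QuantumVariables.p (i j : ι) : k := (Q.chr i (Q.gr j) : kˣ)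

/-- The defining relations of `G⟨X⟩` on the letters `g ∈ G` and `x_i`, `i ∈ ι`:
those of the group `G`, and `x_i g = χ^i(g) g x_i`. -/
inductive SkewRel : FreeAlgebra k (G ⊕ ι) → FreeAlgebra k (G ⊕ ι) → Prop
  | one : SkewRel (FreeAlgebra.ι k (Sum.inl 1)) 1
  | mul (g h : G) : SkewRel (FreeAlgebra.ι k (Sum.inl (g * h)))
      (FreeAlgebra.ι k (Sum.inl g) * FreeAlgebra.ι k (Sum.inl h))
  | comm (i : ι) (g : G) : SkewRel (FreeAlgebra.ι k (Sum.inr i) * FreeAlgebra.ι k (Sum.inl g))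
      ((Q.chr i g : k) • (FreeAlgebra.ι k (Sum.inl g) * FreeAlgebra.ι k (Sum.inr i)))

/-- The skew group algebra `G⟨X⟩` generated by `G` and `k⟨X⟩`
with the commutation rules `x_i g = χ^i(g) g x_i`. -/
def SkewGroupAlgebra : Type _ := RingQuot (SkewRel Q)

noncomputable instance : Ring (SkewGroupAlgebra Q) :=
  inferInstanceAs (Ring (RingQuot (SkewRel Q)))

noncomputable instance : Algebra k (SkewGroupAlgebra Q) :=
  inferInstanceAs (Algebra k (RingQuot (SkewRel Q)))

namespace SkewGroupAlgebra

/-- The quotient map from the free algebra on the letters `g ∈ G` and `x_i`. -/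
noncomputable def mk : FreeAlgebra k (G ⊕ ι) →ₐ[k] SkewGroupAlgebra Q :=
  RingQuot.mkAlgHom k (SkewRel Q)

/-- The variable `x_i` in `G⟨X⟩`. -/
noncomputable def x (i : ι) : SkewGroupAlgebra Q := mk Q (FreeAlgebra.ι k (Sum.inr i))

/-- The embedding of the group `G` in `G⟨X⟩`. -/
noncomputable def grp : G →* SkewGroupAlgebra Q where
  toFun g := mk Q (FreeAlgebra.ι k (Sum.inl g))
  map_one' := (RingQuot.mkAlgHom_rel k SkewRel.one).trans (map_one (mk Q))
  map_mul' g h := (RingQuot.mkAlgHom_rel k (SkewRel.mul g h)).trans (map_mul (mk Q) _ _)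

theorem x_mul_grp (i : ι) (g : G) :
    x Q i * grp Q g = (Q.chr i g : k) • (grp Q g * x Q i) := by
  have h := RingQuot.mkAlgHom_rel k (SkewRel.comm (Q := Q) i g)
  change mk Q _ = mk Q _ at h
  rw [map_mul, map_smul, map_mul] at h
  exact h

variable {Q} in
/-- Algebra homomorphisms out of `G⟨X⟩` are given by the images of `g ∈ G` and of the `x_i`. -/
noncomputable def lift {B : Type*} [Ring B] [Algebra k B] (φ : G →* B) (y : ι → B)
    (h : ∀ i g, y i * φ g = (Q.chr i g : k) • (φ g * y i)) : SkewGroupAlgebra Q →ₐ[k] B :=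
  RingQuot.liftAlgHom k (s := SkewRel Q)
    ⟨FreeAlgebra.lift k (Sum.elim φ y), by
      intro a b hab
      induction hab with
      | one => simp
      | mul g h => simp
      | comm i g => simp [h]⟩

section lift

variable {B : Type*} [Ring B] [Algebra k B] (φ : G →* B) (y : ι → B)
    (h : ∀ i g, y i * φ g = (Q.chr i g : k) • (φ g * y i))

theorem lift_x (i : ι) : lift φ y h (x Q i) = y i := by
  refine (RingQuot.liftAlgHom_mkAlgHom_apply k _ _ _).trans ?_
  simp

theorem lift_grp (g : G) : lift φ y h (grp Q g) = φ g := by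
  refine (RingQuot.liftAlgHom_mkAlgHom_apply k _ _ _).trans ?_
  simp

variable {Q} in
theorem hom_ext {f f' : SkewGroupAlgebra Q →ₐ[k] B} (hg : ∀ g, f (grp Q g) = f' (grp Q g))
    (hx : ∀ i, f (x Q i) = f' (x Q i)) : f = f' := by
  refine RingQuot.ringQuot_ext' k f f' ?_
  ext a
  rcases a with g | i
  · exact hg g
  · exact hx i

end lift

/-- The group-like elements `g ⊗ g`. -/
noncomputable def grpTensor : G →* SkewGroupAlgebra Q ⊗[k] SkewGroupAlgebra Q where
  toFun g := grp Q g ⊗ₜ[k] grp Q g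
  map_one' := by simp [Algebra.TensorProduct.one_def]
  map_mul' := by simp

/-- The coproduct of `G⟨X⟩`: `Δ(g) = g ⊗ g` and `Δ(x_i) = x_i ⊗ 1 + g_i ⊗ x_i`. -/
noncomputable def comul : SkewGroupAlgebra Q →ₐ[k] SkewGroupAlgebra Q ⊗[k] SkewGroupAlgebra Q :=
  lift (grpTensor Q) (fun i => x Q i ⊗ₜ[k] 1 + grp Q (Q.gr i) ⊗ₜ[k] x Q i) (by
    intro i g
    change _ * (grp Q g ⊗ₜ[k] grp Q g) = _ • ((grp Q g ⊗ₜ[k] grp Q g) * _)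
    have hc : grp Q (Q.gr i) * grp Q g = grp Q g * grp Q (Q.gr i) := by
      rw [← map_mul, ← map_mul, mul_comm]
    simp only [add_mul, mul_add, Algebra.TensorProduct.tmul_mul_tmul, x_mul_grp, one_mul, mul_one,
      smul_add, TensorProduct.tmul_smul, TensorProduct.smul_tmul', hc])

theorem comul_x (i : ι) : comul Q (x Q i) = x Q i ⊗ₜ[k] 1 + grp Q (Q.gr i) ⊗ₜ[k] x Q i :=
  lift_x Q _ _ _ i

theorem comul_grp (g : G) : comul Q (grp Q g) = grp Q g ⊗ₜ[k] grp Q g :=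
  lift_grp Q _ _ _ g

/-- The counit of `G⟨X⟩`: `ε(g) = 1` and `ε(x_i) = 0`. -/
noncomputable def counit : SkewGroupAlgebra Q →ₐ[k] k :=
  lift 1 (fun _ => 0) (by simp)

theorem counit_x (i : ι) : counit Q (x Q i) = 0 := lift_x Q _ _ _ i

theorem counit_grp (g : G) : counit Q (grp Q g) = 1 := lift_grp Q _ _ _ g

noncomputable instance : Bialgebra k (SkewGroupAlgebra Q) :=
  Bialgebra.ofAlgHom (comul Q) (counit Q)
    (by
      apply hom_ext
      · intro g; simp [comul_grp]
      · intro i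
        simp [comul_x, comul_grp, TensorProduct.add_tmul, TensorProduct.tmul_add,
          Algebra.TensorProduct.one_def, add_assoc])
    (by
      apply hom_ext
      · intro g; simp [comul_grp, counit_grp]
      · intro i; simp [comul_x, counit_grp, counit_x])
    (by
      apply hom_ext
      · intro g; simp [comul_grp, counit_grp]
      · intro i; simp [comul_x, counit_x])

end SkewGroupAlgebra

open SkewGroupAlgebra

/-! Skew brackets. A bracketed word in the letters `x_i` is an element of the free magma on `ι`. -/

/-- `g_w`: every letter `x_i` of the word is replaced with `g_i`. -/
def wordGr : FreeMagma ι → G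
  | .of i => Q.gr i
  | .mul u v => wordGr u * wordGr v

/-- `χ^w`: every letter `x_i` of the word is replaced with `χ^i`. -/
def wordChr : FreeMagma ι → G →* kˣ
  | .of i => Q.chr i
  | .mul u v => wordChr u * wordChr v

/-- The value in `G⟨X⟩` of a bracketed word,
the brackets being the skew brackets `[u, v] = u v - χ^u(g_v) v u`. -/
noncomputable def skewBracket : FreeMagma ι → SkewGroupAlgebra Q
  | .of i => x Q i
  | .mul u v => skewBracket u * skewBracket v
      - (wordChr Q u (wordGr Q v) : k) • (skewBracket v * skewBracket u)

/-- The bracketed word `[x_i x_j^m] = [… [[x_i, x_j], x_j], …, x_j]`. -/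
def rightWord (i j : ι) : ℕ → FreeMagma ι
  | 0 => .of i
  | m + 1 => .mul (rightWord i j m) (.of j)

/-- The bracketed word `[x_j^m x_i] = [x_j, [x_j, …, [x_j, x_i] …]]`. -/
def leftWord (j i : ι) : ℕ → FreeMagma ι
  | 0 => .of i
  | m + 1 => .mul (.of j) (leftWord j i m)

/-! The coproduct of these words (needed to see that the Serre relations span a biideal). -/

theorem skewBracket_mul_grp (w : FreeMagma ι) (h : G) :
    skewBracket Q w * grp Q h = (wordChr Q w h : k) • (grp Q h * skewBracket Q w) := by
  induction w with
  | ih1 i => exact x_mul_grp Q i h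
  | ih2 u v hu hv =>
    have e : ∀ a b : FreeMagma ι,
        skewBracket Q a * grp Q h = (wordChr Q a h : k) • (grp Q h * skewBracket Q a) →
        skewBracket Q b * grp Q h = (wordChr Q b h : k) • (grp Q h * skewBracket Q b) →
        skewBracket Q a * skewBracket Q b * grp Q h =
          ((wordChr Q a h : k) * (wordChr Q b h : k)) •
            (grp Q h * (skewBracket Q a * skewBracket Q b)) := by
      intro a b ha hb
      rw [mul_assoc, hb, mul_smul_comm, ← mul_assoc, ha, smul_mul_assoc, smul_smul, mul_assoc,
        mul_comm (wordChr Q b h : k)]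
    change (skewBracket Q u * skewBracket Q v
      - (wordChr Q u (wordGr Q v) : k) • (skewBracket Q v * skewBracket Q u)) * grp Q h =
      (((wordChr Q u * wordChr Q v) h : kˣ) : k) • (grp Q h * (skewBracket Q u * skewBracket Q v
      - (wordChr Q u (wordGr Q v) : k) • (skewBracket Q v * skewBracket Q u)))
    rw [sub_mul, smul_mul_assoc, e u v hu hv, e v u hv hu, mul_sub, smul_sub, mul_smul_comm,
      smul_smul, smul_smul, MonoidHom.mul_apply, Units.val_mul]
    congr 2
    ring

theorem wordChr_rightWord (i j : ι) (m : ℕ) (h : G) :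
    (wordChr Q (rightWord i j m) h : k) = (Q.chr i h : k) * (Q.chr j h : k) ^ m := by
  induction m with
  | zero => simp [rightWord, wordChr]
  | succ m ih => simp [rightWord, wordChr, ih, pow_succ, mul_assoc]

theorem wordChr_leftWord (j i : ι) (m : ℕ) (h : G) :
    (wordChr Q (leftWord j i m) h : k) = (Q.chr j h : k) ^ m * (Q.chr i h : k) := by
  induction m with
  | zero => simp [leftWord, wordChr]
  | succ m ih => simp [leftWord, wordChr, ih, pow_succ', mul_assoc]

theorem wordGr_leftWord (j i : ι) (m : ℕ) :
    wordGr Q (leftWord j i m) = Q.gr j ^ m * Q.gr i := by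
  induction m with
  | zero => simp [leftWord, wordGr]
  | succ m ih => simp [leftWord, wordGr, ih, pow_succ', mul_assoc]

theorem skewBracket_rightWord_succ (i j : ι) (m : ℕ) :
    skewBracket Q (rightWord i j (m + 1)) = skewBracket Q (rightWord i j m) * x Q j
      - (Q.p i j * Q.p j j ^ m) • (x Q j * skewBracket Q (rightWord i j m)) := by
  simp [rightWord, skewBracket, wordChr_rightWord, QuantumVariables.p, wordGr]

theorem skewBracket_leftWord_succ (j i : ι) (m : ℕ) :
    skewBracket Q (leftWord j i (m + 1)) = x Q j * skewBracket Q (leftWord j i m)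
      - (Q.p j j ^ m * Q.p j i) • (skewBracket Q (leftWord j i m) * x Q j) := by
  simp [leftWord, skewBracket, wordGr_leftWord, QuantumVariables.p, wordChr]

theorem x_pow_mul_grp (j : ι) (n : ℕ) (h : G) :
    x Q j ^ n * grp Q h = ((Q.chr j h : k) ^ n) • (grp Q h * x Q j ^ n) := by
  induction n with
  | zero => simp
  | succ n ih =>
    rw [pow_succ, mul_assoc, x_mul_grp, mul_smul_comm, ← mul_assoc, ih, smul_mul_assoc, smul_smul,
      mul_assoc, pow_succ' (Q.chr j h : k)]

/-- The terms `g_i g_j^m x_j^l ⊗ [x_i x_j^m]`. -/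
noncomputable def rightTerm (i j : ι) (l m : ℕ) : SkewGroupAlgebra Q ⊗[k] SkewGroupAlgebra Q :=
  (grp Q (Q.gr i * Q.gr j ^ m) * x Q j ^ l) ⊗ₜ[k] skewBracket Q (rightWord i j m)

/-- The terms `g_j^l [x_j^m x_i] ⊗ x_j^l`. -/
noncomputable def leftTerm (j i : ι) (m l : ℕ) : SkewGroupAlgebra Q ⊗[k] SkewGroupAlgebra Q :=
  (grp Q (Q.gr j ^ l) * skewBracket Q (leftWord j i m)) ⊗ₜ[k] (x Q j ^ l)

theorem rightTerm_step (i j : ι) (l m : ℕ) :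
    rightTerm Q i j l m * comul Q (x Q j)
      - (Q.p i j * Q.p j j ^ (l + m)) • (comul Q (x Q j) * rightTerm Q i j l m) =
    (1 - Q.p i j * Q.p j i * Q.p j j ^ (l + 2 * m)) • rightTerm Q i j (l + 1) m
      + Q.p j j ^ l • rightTerm Q i j l (m + 1) := by
  have h1 : x Q j * (grp Q (Q.gr i * Q.gr j ^ m) * x Q j ^ l) =
      (Q.p j i * Q.p j j ^ m) • (grp Q (Q.gr i * Q.gr j ^ m) * x Q j ^ (l + 1)) := by
    rw [← mul_assoc, x_mul_grp, smul_mul_assoc, mul_assoc, ← pow_succ']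
    simp [QuantumVariables.p]
  have h2 : grp Q (Q.gr i * Q.gr j ^ m) * x Q j ^ l * grp Q (Q.gr j) =
      (Q.p j j ^ l) • (grp Q (Q.gr i * Q.gr j ^ (m + 1)) * x Q j ^ l) := by
    rw [mul_assoc, x_pow_mul_grp, mul_smul_comm, ← mul_assoc, ← map_mul, mul_assoc, ← pow_succ]
    rfl
  have h3 : grp Q (Q.gr j) * (grp Q (Q.gr i * Q.gr j ^ m) * x Q j ^ l) =
      grp Q (Q.gr i * Q.gr j ^ (m + 1)) * x Q j ^ l := by
    rw [← mul_assoc, ← map_mul, mul_comm, mul_assoc, ← pow_succ]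
  simp only [rightTerm, comul_x, add_mul, mul_add, Algebra.TensorProduct.tmul_mul_tmul, h1, h2, h3,
    mul_one, one_mul, skewBracket_rightWord_succ, TensorProduct.tmul_sub, TensorProduct.tmul_smul,
    ← TensorProduct.smul_tmul', mul_assoc, ← pow_succ]
  module

theorem leftTerm_step (j i : ι) (m l : ℕ) :
    comul Q (x Q j) * leftTerm Q j i m l
      - (Q.p j j ^ (m + l) * Q.p j i) • (leftTerm Q j i m l * comul Q (x Q j)) =
    Q.p j j ^ l • leftTerm Q j i (m + 1) l
      + (1 - Q.p i j * Q.p j i * Q.p j j ^ (2 * m + l)) • leftTerm Q j i m (l + 1) := by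
  have h1 : x Q j * (grp Q (Q.gr j ^ l) * skewBracket Q (leftWord j i m)) =
      (Q.p j j ^ l) • (grp Q (Q.gr j ^ l) * (x Q j * skewBracket Q (leftWord j i m))) := by
    rw [← mul_assoc, x_mul_grp, smul_mul_assoc, mul_assoc]
    simp [QuantumVariables.p]
  have h2 : grp Q (Q.gr j ^ l) * skewBracket Q (leftWord j i m) * grp Q (Q.gr j) =
      (Q.p j j ^ m * Q.p i j) •
        (grp Q (Q.gr j ^ (l + 1)) * skewBracket Q (leftWord j i m)) := by
    rw [mul_assoc, skewBracket_mul_grp, mul_smul_comm, ← mul_assoc, ← map_mul, ← pow_succ,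
      wordChr_leftWord]
    rfl
  have h3 : grp Q (Q.gr j) * (grp Q (Q.gr j ^ l) * skewBracket Q (leftWord j i m)) =
      grp Q (Q.gr j ^ (l + 1)) * skewBracket Q (leftWord j i m) := by
    rw [← mul_assoc, ← map_mul, ← pow_succ']
  simp only [leftTerm, comul_x, add_mul, mul_add, Algebra.TensorProduct.tmul_mul_tmul, h1, h2, h3,
    mul_one, one_mul, skewBracket_leftWord_succ, mul_sub, TensorProduct.sub_tmul, mul_smul_comm,
    ← TensorProduct.smul_tmul', ← pow_succ, ← pow_succ']
  simp only [mul_assoc]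
  module

theorem rightTop_step (i j : ι) (n : ℕ) :
    (skewBracket Q (rightWord i j n) ⊗ₜ[k] 1) * comul Q (x Q j)
      - (Q.p i j * Q.p j j ^ n) •
        (comul Q (x Q j) * (skewBracket Q (rightWord i j n) ⊗ₜ[k] 1)) =
    skewBracket Q (rightWord i j (n + 1)) ⊗ₜ[k] (1 : SkewGroupAlgebra Q) := by
  have h : skewBracket Q (rightWord i j n) * grp Q (Q.gr j) =
      (Q.p i j * Q.p j j ^ n) • (grp Q (Q.gr j) * skewBracket Q (rightWord i j n)) := by
    rw [skewBracket_mul_grp, wordChr_rightWord]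
    rfl
  simp only [comul_x, add_mul, mul_add, Algebra.TensorProduct.tmul_mul_tmul, h, mul_one, one_mul,
    skewBracket_rightWord_succ, TensorProduct.sub_tmul, ← TensorProduct.smul_tmul']
  module

theorem leftTop_step (j i : ι) (n : ℕ) :
    comul Q (x Q j) * (grp Q (Q.gr j ^ n * Q.gr i) ⊗ₜ[k] skewBracket Q (leftWord j i n))
      - (Q.p j j ^ n * Q.p j i) •
        ((grp Q (Q.gr j ^ n * Q.gr i) ⊗ₜ[k] skewBracket Q (leftWord j i n)) * comul Q (x Q j)) =
    grp Q (Q.gr j ^ (n + 1) * Q.gr i) ⊗ₜ[k] skewBracket Q (leftWord j i (n + 1)) := by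
  have h1 : x Q j * grp Q (Q.gr j ^ n * Q.gr i) =
      (Q.p j j ^ n * Q.p j i) • (grp Q (Q.gr j ^ n * Q.gr i) * x Q j) := by
    rw [x_mul_grp]
    simp [QuantumVariables.p]
  have h2 : grp Q (Q.gr j) * grp Q (Q.gr j ^ n * Q.gr i) =
      grp Q (Q.gr j ^ (n + 1) * Q.gr i) := by
    rw [← map_mul, ← mul_assoc, ← pow_succ']
  have h3 : grp Q (Q.gr j ^ n * Q.gr i) * grp Q (Q.gr j) =
      grp Q (Q.gr j ^ (n + 1) * Q.gr i) := by
    rw [← map_mul, mul_comm, ← mul_assoc, ← pow_succ']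
  simp only [comul_x, add_mul, mul_add, Algebra.TensorProduct.tmul_mul_tmul, h1, h2, h3, mul_one,
    one_mul, skewBracket_leftWord_succ, TensorProduct.tmul_sub, TensorProduct.tmul_smul,
    ← TensorProduct.smul_tmul']
  module

/-- If `p_ij p_ji p_jj^3 = 1`, then `[x_i x_j^4]` is skew-primitive. -/
theorem comul_rightWord_four (i j : ι) (h : Q.p i j * Q.p j i * Q.p j j ^ 3 = 1) :
    comul Q (skewBracket Q (rightWord i j 4)) =
      skewBracket Q (rightWord i j 4) ⊗ₜ[k] 1
        + grp Q (Q.gr i * Q.gr j ^ 4) ⊗ₜ[k] skewBracket Q (rightWord i j 4) := by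
  have hs : ∀ n, comul Q (skewBracket Q (rightWord i j (n + 1))) =
      comul Q (skewBracket Q (rightWord i j n)) * comul Q (x Q j)
      - (Q.p i j * Q.p j j ^ n) •
        (comul Q (x Q j) * comul Q (skewBracket Q (rightWord i j n))) := by
    intro n
    rw [skewBracket_rightWord_succ, map_sub, map_smul, map_mul, map_mul]
  have key : ∀ (n : ℕ) (c : ℕ → k), comul Q (skewBracket Q (rightWord i j n)) =
      skewBracket Q (rightWord i j n) ⊗ₜ[k] 1
        + ∑ l ∈ Finset.range (n + 1), c l • rightTerm Q i j l (n - l) →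
      comul Q (skewBracket Q (rightWord i j (n + 1))) =
      skewBracket Q (rightWord i j (n + 1)) ⊗ₜ[k] 1
        + ∑ l ∈ Finset.range (n + 1), c l •
          ((1 - Q.p i j * Q.p j i * Q.p j j ^ (l + 2 * (n - l))) • rightTerm Q i j (l + 1) (n - l)
            + Q.p j j ^ l • rightTerm Q i j l (n - l + 1)) := by
    intro n c hc
    rw [hs, hc, ← rightTop_step, add_mul, mul_add, Finset.sum_mul, Finset.mul_sum, smul_add,
      Finset.smul_sum, add_sub_add_comm, ← Finset.sum_sub_distrib]
    congr 1
    refine Finset.sum_congr rfl fun l hl => ?_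
    have hl' : l + (n - l) = n := by
      have := Finset.mem_range.1 hl
      omega
    rw [← rightTerm_step, hl', smul_sub, smul_mul_assoc, mul_smul_comm, smul_comm]
  have e0 : comul Q (skewBracket Q (rightWord i j 0)) =
      skewBracket Q (rightWord i j 0) ⊗ₜ[k] 1
        + ∑ l ∈ Finset.range (0 + 1), (1 : k) • rightTerm Q i j l (0 - l) := by
    simp [rightTerm, rightWord, skewBracket, comul_x]
  generalize Q.p i j * Q.p j i = L at *
  generalize Q.p j j = q at *
  have e1 := key 0 _ e0
  simp only [Finset.sum_range_succ, Finset.sum_range_zero] at e1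
  have e1' : comul Q (skewBracket Q (rightWord i j 1)) =
      skewBracket Q (rightWord i j 1) ⊗ₜ[k] (1 : SkewGroupAlgebra Q) + ∑ l ∈ Finset.range (1 + 1),
        (fun l => match l with
          | 0 => 1
          | _ => 1 - L : ℕ → k) l • rightTerm Q i j l (1 - l) := by
    rw [e1]
    simp only [Finset.sum_range_succ, Finset.sum_range_zero, Nat.sub_zero, Nat.sub_self, zero_add]
    module
  have e2 := key 1 _ e1'
  have e2' : comul Q (skewBracket Q (rightWord i j 2)) =
      skewBracket Q (rightWord i j 2) ⊗ₜ[k] (1 : SkewGroupAlgebra Q) + ∑ l ∈ Finset.range (2 + 1),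
        (fun l => match l with
          | 0 => 1
          | 1 => (1 + q) * (1 - L * q)
          | _ => (1 - L) * (1 - L * q) : ℕ → k) l • rightTerm Q i j l (2 - l) := by
    rw [e2]
    simp only [Finset.sum_range_succ, Finset.sum_range_zero, Nat.sub_zero, Nat.sub_self, zero_add,
      Nat.reduceSub, Nat.reduceAdd]
    module
  have e3 := key 2 _ e2'
  have e3' : comul Q (skewBracket Q (rightWord i j 3)) =
      skewBracket Q (rightWord i j 3) ⊗ₜ[k] (1 : SkewGroupAlgebra Q) + ∑ l ∈ Finset.range (3 + 1),
        (fun l => match l with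
          | 0 => 1
          | 1 => (1 + q + q ^ 2) * (1 - L * q ^ 2)
          | 2 => (1 + q + q ^ 2) * (1 - L * q) * (1 - L * q ^ 2)
          | _ => (1 - L) * (1 - L * q) * (1 - L * q ^ 2) : ℕ → k) l •
            rightTerm Q i j l (3 - l) := by
    rw [e3]
    simp only [Finset.sum_range_succ, Finset.sum_range_zero, Nat.sub_zero, Nat.sub_self, zero_add,
      Nat.reduceSub, Nat.reduceAdd]
    module
  have e4 := key 3 _ e3'
  have e4' : comul Q (skewBracket Q (rightWord i j 4)) =
      skewBracket Q (rightWord i j 4) ⊗ₜ[k] 1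
        + (rightTerm Q i j 0 4
          + ((1 + q) * (1 + q ^ 2) * (1 - L * q ^ 3)) • rightTerm Q i j 1 3
          + ((1 + q ^ 2) * (1 + q + q ^ 2) * (1 - L * q ^ 2) * (1 - L * q ^ 3)) •
            rightTerm Q i j 2 2
          + ((1 + q) * (1 + q ^ 2) * (1 - L * q) * (1 - L * q ^ 2) * (1 - L * q ^ 3)) •
            rightTerm Q i j 3 1
          + ((1 - L) * (1 - L * q) * (1 - L * q ^ 2) * (1 - L * q ^ 3)) •
            rightTerm Q i j 4 0) := by
    rw [e4]
    simp only [Finset.sum_range_succ, Finset.sum_range_zero, Nat.sub_zero, Nat.sub_self, zero_add,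
      Nat.reduceSub, Nat.reduceAdd]
    module
  rw [e4', h]
  simp [rightTerm]

/-- If `p_ij p_ji p_jj = 1`, then `[x_j^2 x_i]` is skew-primitive. -/
theorem comul_leftWord_two (j i : ι) (h : Q.p i j * Q.p j i * Q.p j j = 1) :
    comul Q (skewBracket Q (leftWord j i 2)) =
      skewBracket Q (leftWord j i 2) ⊗ₜ[k] 1
        + grp Q (Q.gr j ^ 2 * Q.gr i) ⊗ₜ[k] skewBracket Q (leftWord j i 2) := by
  have hs : ∀ n, comul Q (skewBracket Q (leftWord j i (n + 1))) =
      comul Q (x Q j) * comul Q (skewBracket Q (leftWord j i n))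
      - (Q.p j j ^ n * Q.p j i) •
        (comul Q (skewBracket Q (leftWord j i n)) * comul Q (x Q j)) := by
    intro n
    rw [skewBracket_leftWord_succ, map_sub, map_smul, map_mul, map_mul]
  have t0 := leftTop_step Q j i 0
  have t1 := leftTop_step Q j i 1
  have s00 := leftTerm_step Q j i 0 0
  have s10 := leftTerm_step Q j i 1 0
  have s01 := leftTerm_step Q j i 0 1
  have e0 : comul Q (skewBracket Q (leftWord j i 0)) =
      leftTerm Q j i 0 0
        + grp Q (Q.gr j ^ 0 * Q.gr i) ⊗ₜ[k] skewBracket Q (leftWord j i 0) := by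
    simp [leftTerm, leftWord, skewBracket, comul_x]
  have e1 : comul Q (skewBracket Q (leftWord j i 1)) =
      leftTerm Q j i 1 0 + (1 - Q.p i j * Q.p j i) • leftTerm Q j i 0 1
        + grp Q (Q.gr j ^ 1 * Q.gr i) ⊗ₜ[k] skewBracket Q (leftWord j i 1) := by
    rw [hs, e0, ← t0]
    simp only [zero_add, mul_zero, add_zero, pow_zero, one_smul, mul_one] at s00 ⊢
    rw [← s00, mul_add, add_mul]
    module
  have e2 : comul Q (skewBracket Q (leftWord j i 2)) =
      leftTerm Q j i 2 0
        + ((1 + Q.p j j) * (1 - Q.p i j * Q.p j i * Q.p j j)) • leftTerm Q j i 1 1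
        + ((1 - Q.p i j * Q.p j i) * (1 - Q.p i j * Q.p j i * Q.p j j)) • leftTerm Q j i 0 2
        + grp Q (Q.gr j ^ 2 * Q.gr i) ⊗ₜ[k] skewBracket Q (leftWord j i 2) := by
    have r : leftTerm Q j i 2 0
        + ((1 + Q.p j j) * (1 - Q.p i j * Q.p j i * Q.p j j)) • leftTerm Q j i 1 1
        + ((1 - Q.p i j * Q.p j i) * (1 - Q.p i j * Q.p j i * Q.p j j)) • leftTerm Q j i 0 2
        = (Q.p j j ^ 0 • leftTerm Q j i (1 + 1) 0
      + (1 - Q.p i j * Q.p j i * Q.p j j ^ (2 * 1 + 0)) • leftTerm Q j i 1 (0 + 1))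
        + (1 - Q.p i j * Q.p j i) • (Q.p j j ^ 1 • leftTerm Q j i (0 + 1) 1
      + (1 - Q.p i j * Q.p j i * Q.p j j ^ (2 * 0 + 1)) • leftTerm Q j i 0 (1 + 1)) := by
      simp only [Nat.reduceAdd, Nat.reduceMul]
      module
    rw [hs, e1, r, ← t1, ← s10, ← s01]
    simp only [add_zero, zero_add, mul_add, add_mul, smul_mul_assoc, mul_smul_comm]
    module
  rw [e2, h]
  simp [leftTerm]

end Skew

section TypeG2

variable {k G : Type*} [Field k] [CommGroup G]

/-- The conditions on the quantization parameters for the type `G₂`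
(`x_1`, `x_2` are indexed by `0`, `1 : Fin 2`):
`p_11 = p_12⁻¹ p_21⁻¹ = p_22³ ≠ 1` and `p_22 ≠ -1`. -/
class QuantumVariables.IsTypeG2 (Q : QuantumVariables k G (Fin 2)) : Prop where
  p11_eq : Q.p 0 0 = (Q.p 0 1)⁻¹ * (Q.p 1 0)⁻¹
  p12_p21 : (Q.p 0 1)⁻¹ * (Q.p 1 0)⁻¹ = Q.p 1 1 ^ 3
  p22_cube_ne : Q.p 1 1 ^ 3 ≠ 1
  p22_ne : Q.p 1 1 ≠ -1

variable (Q : QuantumVariables k G (Fin 2))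

/-- The quantum Serre relations `[x_1 x_2^4] = 0` and `[x_1^2 x_2] = 0` of type `G₂`. -/
inductive SerreRel : SkewGroupAlgebra Q → SkewGroupAlgebra Q → Prop
  | right : SerreRel (skewBracket Q (rightWord 0 1 4)) 0
  | left : SerreRel (skewBracket Q (leftWord 0 1 2)) 0

/-- The quantum Borel algebra `U_q^+(𝔤)`: the quotient of `G⟨x_1, x_2⟩` by the
quantum Serre relations of type `G₂`. -/
def QuantumBorelG2 : Type _ := RingQuot (SerreRel Q)

noncomputable instance : Ring (QuantumBorelG2 Q) :=
  inferInstanceAs (Ring (RingQuot (SerreRel Q)))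

noncomputable instance : Algebra k (QuantumBorelG2 Q) :=
  inferInstanceAs (Algebra k (RingQuot (SerreRel Q)))

namespace QuantumBorelG2

/-- The quotient map `G⟨x_1, x_2⟩ → U_q^+(𝔤)`. -/
noncomputable def proj : SkewGroupAlgebra Q →ₐ[k] QuantumBorelG2 Q :=
  RingQuot.mkAlgHom k (SerreRel Q)

theorem proj_right : proj Q (skewBracket Q (rightWord 0 1 4)) = 0 :=
  (RingQuot.mkAlgHom_rel k SerreRel.right).trans (map_zero (proj Q))

theorem proj_left : proj Q (skewBracket Q (leftWord 0 1 2)) = 0 :=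
  (RingQuot.mkAlgHom_rel k SerreRel.left).trans (map_zero (proj Q))

theorem p_ne_zero (i j : Fin 2) : Q.p i j ≠ 0 := Units.ne_zero _

theorem hom_ext {B : Type*} [Ring B] [Algebra k B] {f f' : QuantumBorelG2 Q →ₐ[k] B}
    (hg : ∀ g, f (proj Q (SkewGroupAlgebra.grp Q g)) = f' (proj Q (SkewGroupAlgebra.grp Q g)))
    (hx : ∀ i, f (proj Q (SkewGroupAlgebra.x Q i)) = f' (proj Q (SkewGroupAlgebra.x Q i))) :
    f = f' :=
  RingQuot.ringQuot_ext' k f f' (SkewGroupAlgebra.hom_ext (f := f.comp (proj Q))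
    (f' := f'.comp (proj Q)) hg hx)

/-- The counit of `U_q^+(𝔤)`, induced by that of `G⟨x_1, x_2⟩`. -/
noncomputable def counit : QuantumBorelG2 Q →ₐ[k] k :=
  RingQuot.liftAlgHom k (s := SerreRel Q)
    ⟨SkewGroupAlgebra.counit Q, by
      intro a b hab
      induction hab with
      | right => simp [skewBracket_rightWord_succ, SkewGroupAlgebra.counit_x]
      | left => simp [skewBracket_leftWord_succ, SkewGroupAlgebra.counit_x]⟩

theorem counit_proj (a : SkewGroupAlgebra Q) :
    counit Q (proj Q a) = SkewGroupAlgebra.counit Q a :=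
  RingQuot.liftAlgHom_mkAlgHom_apply k _ _ a

section

variable [Q.IsTypeG2]

theorem p_right : Q.p 0 1 * Q.p 1 0 * Q.p 1 1 ^ 3 = 1 := by
  rw [← QuantumVariables.IsTypeG2.p12_p21]
  field_simp [p_ne_zero Q]

theorem p_left : Q.p 1 0 * Q.p 0 1 * Q.p 0 0 = 1 := by
  rw [QuantumVariables.IsTypeG2.p11_eq]
  field_simp [p_ne_zero Q]

/-- The coproduct of `U_q^+(𝔤)`, induced by that of `G⟨x_1, x_2⟩`. -/
noncomputable def comul : QuantumBorelG2 Q →ₐ[k] QuantumBorelG2 Q ⊗[k] QuantumBorelG2 Q :=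
  RingQuot.liftAlgHom k (s := SerreRel Q)
    ⟨(Algebra.TensorProduct.map (proj Q) (proj Q)).comp (SkewGroupAlgebra.comul Q), by
      intro a b hab
      induction hab with
      | right => simp [comul_rightWord_four Q 0 1 (p_right Q), proj_right]
      | left => simp [comul_leftWord_two Q 0 1 (p_left Q), proj_left]⟩

theorem comul_proj (a : SkewGroupAlgebra Q) : comul Q (proj Q a) =
    Algebra.TensorProduct.map (proj Q) (proj Q) (SkewGroupAlgebra.comul Q a) :=
  RingQuot.liftAlgHom_mkAlgHom_apply k _ _ a

noncomputable instance : Bialgebra k (QuantumBorelG2 Q) :=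
  Bialgebra.ofAlgHom (comul Q) (counit Q)
    (by
      apply hom_ext
      · intro g; simp [comul_proj, SkewGroupAlgebra.comul_grp]
      · intro i
        simp [comul_proj, SkewGroupAlgebra.comul_x, SkewGroupAlgebra.comul_grp,
          TensorProduct.add_tmul, TensorProduct.tmul_add, Algebra.TensorProduct.one_def,
          add_assoc])
    (by
      apply hom_ext
      · intro g; simp [comul_proj, counit_proj, SkewGroupAlgebra.comul_grp, SkewGroupAlgebra.counit_grp]
      · intro i; simp [comul_proj, counit_proj, SkewGroupAlgebra.comul_x, SkewGroupAlgebra.counit_grp, SkewGroupAlgebra.counit_x])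
    (by
      apply hom_ext
      · intro g; simp [comul_proj, counit_proj, SkewGroupAlgebra.comul_grp, SkewGroupAlgebra.counit_grp]
      · intro i; simp [comul_proj, counit_proj, SkewGroupAlgebra.comul_x, SkewGroupAlgebra.counit_x])

end

/-- The generator `x_i` of `U_q^+(𝔤)`. -/
noncomputable def x (i : Fin 2) : QuantumBorelG2 Q := proj Q (SkewGroupAlgebra.x Q i)

/-- The group-like elements `g ∈ G` of `U_q^+(𝔤)`. -/
noncomputable def grp : G →* QuantumBorelG2 Q :=
  (proj Q : SkewGroupAlgebra Q →* QuantumBorelG2 Q).comp (SkewGroupAlgebra.grp Q)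

theorem comul_x [Q.IsTypeG2] (i : Fin 2) : Coalgebra.comul (R := k) (x Q i) =
    x Q i ⊗ₜ[k] 1 + grp Q (Q.gr i) ⊗ₜ[k] x Q i := by
  refine (comul_proj Q _).trans ?_
  simp [SkewGroupAlgebra.comul_x, x, grp]

theorem comul_grp [Q.IsTypeG2] (g : G) : Coalgebra.comul (R := k) (grp Q g) =
    grp Q g ⊗ₜ[k] grp Q g := by
  refine (comul_proj Q _).trans ?_
  simp [SkewGroupAlgebra.comul_grp, grp]

/-- `[n]_q = 1 + q + ⋯ + q^(n-1)`. -/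
def qInt (q : k) (n : ℕ) : k := ∑ s ∈ Finset.range n, q ^ s

/-- `[n]_q! = [1]_q [2]_q ⋯ [n]_q`. -/
def qFactorial (q : k) (n : ℕ) : k := ∏ s ∈ Finset.range n, qInt q (s + 1)

/-- The normalising denominator `[n]_q! ∏_{s < n} (1 - p_12 p_21 q^s)`, `q = p_22`. -/
def denom (n : ℕ) : k :=
  qFactorial (Q.p 1 1) n * ∏ s ∈ Finset.range n, (1 - Q.p 0 1 * Q.p 1 0 * Q.p 1 1 ^ s)

/-- The denominators that occur below are nonzero. -/
theorem denom_ne_zero [Q.IsTypeG2] (n : ℕ) (hn : n ≤ 3) : denom Q n ≠ 0 := by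
  have h := p_right Q
  have h1 := QuantumVariables.IsTypeG2.p22_cube_ne (Q := Q)
  have h2 := QuantumVariables.IsTypeG2.p22_ne (Q := Q)
  unfold denom qFactorial qInt
  generalize Q.p 0 1 * Q.p 1 0 = L at *
  generalize Q.p 1 1 = q at *
  have a0 : (1 : k) - L ≠ 0 := fun e => h1 (by linear_combination h + q ^ 3 * e)
  have a1 : (1 : k) - L * q ≠ 0 := fun e => by
    have e' : (q - 1) * (q + 1) = 0 := by linear_combination h + q ^ 2 * e
    rcases mul_eq_zero.1 e' with e' | e'
    · exact h1 (by rw [sub_eq_zero.1 e']; simp)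
    · exact h2 (by linear_combination e')
  have a2 : (1 : k) - L * q ^ 2 ≠ 0 := fun e => by
    have e' : q = 1 := by linear_combination h + q * e
    exact h1 (by rw [e']; simp)
  have b2 : (1 : k) + q ≠ 0 := fun e => h2 (by linear_combination e)
  have b3 : (1 : k) + q + q ^ 2 ≠ 0 := fun e => h1 (by linear_combination (q - 1) * e)
  interval_cases n <;> simp [Finset.prod_range_succ, Finset.sum_range_succ, a0, a1, a2, b2, b3]

/-- `{x_1 x_2^n}`, the normalised element `[x_1 x_2^n]`. -/
noncomputable def rightElt (n : ℕ) : QuantumBorelG2 Q :=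
  (denom Q n)⁻¹ • proj Q (skewBracket Q (rightWord 0 1 n))

/-- `{x_2^n x_1}`, the normalised element `[x_2^n x_1]`. -/
noncomputable def leftElt (n : ℕ) : QuantumBorelG2 Q :=
  (denom Q n)⁻¹ • proj Q (skewBracket Q (leftWord 1 0 n))

/-- The element `{x_1 x_2^3 x_1}`; here `q = p_22`. -/
noncomputable def topElt : QuantumBorelG2 Q :=
  -(Q.p 1 0 ^ 2 * ((Q.p 1 1 ^ 3 + Q.p 1 1 ^ 2) / (1 - Q.p 1 1 ^ 3))) •
      (rightElt Q 1 * rightElt Q 2)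
    + (Q.p 1 0 * ((qInt (Q.p 1 1) 4 - 2) / (1 - Q.p 1 1 ^ 3))) • (rightElt Q 2 * rightElt Q 1)
    + rightElt Q 3 * x Q 0

end QuantumBorelG2

end TypeG2

end QuantumBorel

open QuantumBorel

namespace QuantumBorel

/-! ### Coproducts of the words [x_i x_j^n], n ≤ 3, in G⟨X⟩ -/

section

variable {k G ι : Type*} [Field k] [CommGroup G] (Q : QuantumVariables k G ι)

open SkewGroupAlgebra

/-! Write q = p_22, L = p_12 p_21 and R_n = [x_1 x_2^n]. Since Δ is multiplicative, the coproduct of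
the element of degree (2, 3) is found by multiplying those of the R_n, n ≤ 3, each of which is R_n ⊗
1 plus a combination of the tensors g_1 g_2^m x_2^l ⊗ R_m with l + m = n. After division by the
denominators the coefficient of x_2^l ⊗ {x_1 x_2^m} is just 1/[l]_q!.

The products are brought to a normal form: group elements go to the left, every x_2 in the first
factor moves left past the R_n, and products R_a R_b in the second factor are straightened. Only two
such products, R_0 R_1 and R_0 R_2, need a relation, and both follow from [x_1^2 x_2] = 0. The
relation [x_1 x_2^4] = 0 matters only for Δ to descend to the quotient, as R_3 x_2 never occurs. The
elements [x_2^n x_1] are also expanded in the x_2^l R_m (`leftBr_one`, `leftBr_two`,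
`leftBr_three`), so that both sides use the same monomials.

Sort by the degree in x_1 of the first factor. Degree 2 gives the term with ⊗ 1, and degree 1
assembles into the {x_2^{3-k} x_1} ⊗ {x_1 x_2^k}. In degree 0 the part without x_2 on the left is
the group-like term, while x_2 ⊗ R_1 R_1, x_2 ⊗ R_2 R_0, x_2^2 ⊗ R_1 R_0 and x_2^3 ⊗ R_0 R_0 must
cancel. This is what the two coefficients in the definition of {x_1 x_2^3 x_1} achieve. What remains
is an identity of rational functions in p_21 and q for each monomial. -/

theorem comul_rightWord_succ (i j : ι) (n : ℕ) :
    comul Q (skewBracket Q (rightWord i j (n + 1))) =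
      comul Q (skewBracket Q (rightWord i j n)) * comul Q (x Q j)
      - (Q.p i j * Q.p j j ^ n) •
        (comul Q (x Q j) * comul Q (skewBracket Q (rightWord i j n))) := by
  rw [skewBracket_rightWord_succ, map_sub, map_smul, map_mul, map_mul]

theorem comul_rightWord_zero (i j : ι) :
    comul Q (skewBracket Q (rightWord i j 0)) =
      skewBracket Q (rightWord i j 0) ⊗ₜ[k] 1 + rightTerm Q i j 0 0 := by
  simp [rightTerm, rightWord, skewBracket, comul_x]

theorem comul_rightWord_one (i j : ι) :
    comul Q (skewBracket Q (rightWord i j 1)) =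
      skewBracket Q (rightWord i j 1) ⊗ₜ[k] 1 + rightTerm Q i j 0 1
        + (1 - Q.p i j * Q.p j i) • rightTerm Q i j 1 0 := by
  have h0 := rightTerm_step Q i j 0 0
  simp only [zero_add, mul_zero, add_zero, pow_zero, one_smul, mul_one] at h0
  have ht := rightTop_step Q i j 0
  rw [comul_rightWord_succ, comul_rightWord_zero, ← ht]
  simp only [add_mul, mul_add, pow_zero, mul_one]
  linear_combination (norm := module) h0

theorem comul_rightWord_two (i j : ι) :
    comul Q (skewBracket Q (rightWord i j 2)) =
      skewBracket Q (rightWord i j 2) ⊗ₜ[k] 1 + rightTerm Q i j 0 2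
        + ((1 + Q.p j j) * (1 - Q.p i j * Q.p j i * Q.p j j)) • rightTerm Q i j 1 1
        + ((1 - Q.p i j * Q.p j i) * (1 - Q.p i j * Q.p j i * Q.p j j)) •
          rightTerm Q i j 2 0 := by
  have h0 := rightTerm_step Q i j 0 1
  have h1 := rightTerm_step Q i j 1 0
  have ht := rightTop_step Q i j 1
  simp only [Nat.reduceAdd, Nat.reduceMul] at h0 h1 ht
  rw [comul_rightWord_succ, comul_rightWord_one, ← ht]
  simp only [add_mul, mul_add, smul_mul_assoc, mul_smul_comm]
  -- Each step identity is weighted by the coefficient of its tensor in the previous coproduct. The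
  -- scalar of the bracket, p_ij p_jj^(l+m), is the same for all tensors because l + m is constant.
  linear_combination (norm := module) h0 + (1 - Q.p i j * Q.p j i) • h1

/-- The coefficients follow the pattern: Gaussian binomial of 3 over l, times the product of the 1 -
p_ij p_ji p_jj^s for 3 - l ≤ s < 3. The normalising denominators are designed to absorb exactly
these factors. -/
theorem comul_rightWord_three (i j : ι) :
    comul Q (skewBracket Q (rightWord i j 3)) =
      skewBracket Q (rightWord i j 3) ⊗ₜ[k] 1 + rightTerm Q i j 0 3
        + ((1 + Q.p j j + Q.p j j ^ 2) * (1 - Q.p i j * Q.p j i * Q.p j j ^ 2)) •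
          rightTerm Q i j 1 2
        + ((1 + Q.p j j + Q.p j j ^ 2) * (1 - Q.p i j * Q.p j i * Q.p j j)
          * (1 - Q.p i j * Q.p j i * Q.p j j ^ 2)) • rightTerm Q i j 2 1
        + ((1 - Q.p i j * Q.p j i) * (1 - Q.p i j * Q.p j i * Q.p j j)
          * (1 - Q.p i j * Q.p j i * Q.p j j ^ 2)) • rightTerm Q i j 3 0 := by
  have h0 := rightTerm_step Q i j 0 2
  have h1 := rightTerm_step Q i j 1 1
  have h2 := rightTerm_step Q i j 2 0
  have ht := rightTop_step Q i j 2
  simp only [Nat.reduceAdd, Nat.reduceMul] at h0 h1 h2 ht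
  rw [comul_rightWord_succ, comul_rightWord_two, ← ht]
  simp only [add_mul, mul_add, smul_mul_assoc, mul_smul_comm]
  linear_combination (norm := module) h0
    + ((1 + Q.p j j) * (1 - Q.p i j * Q.p j i * Q.p j j)) • h1
    + ((1 - Q.p i j * Q.p j i) * (1 - Q.p i j * Q.p j i * Q.p j j)) • h2

end

/-! ### Transfer to the quotient and commutation with group elements -/

namespace QuantumBorelG2

variable {k G : Type*} [Field k] [CommGroup G] (Q : QuantumVariables k G (Fin 2))

/-- The image of `[x_1 x_2^n]` in `U_q^+(𝔤)`. -/
noncomputable def rightBr (n : ℕ) : QuantumBorelG2 Q := proj Q (skewBracket Q (rightWord 0 1 n))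

/-- The image of `[x_2^n x_1]` in `U_q^+(𝔤)`. -/
noncomputable def leftBr (n : ℕ) : QuantumBorelG2 Q := proj Q (skewBracket Q (leftWord 1 0 n))

/-- The terms `g_1 g_2^m x_2^l ⊗ [x_1 x_2^m]` in `U_q^+(𝔤) ⊗ U_q^+(𝔤)`. -/
noncomputable def rightTens (l m : ℕ) : QuantumBorelG2 Q ⊗[k] QuantumBorelG2 Q :=
  (grp Q (Q.gr 0 * Q.gr 1 ^ m) * x Q 1 ^ l) ⊗ₜ[k] rightBr Q m

theorem rightBr_zero : rightBr Q 0 = x Q 0 := rfl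

theorem leftBr_zero : leftBr Q 0 = x Q 0 := rfl

theorem rightElt_eq (n : ℕ) : rightElt Q n = (denom Q n)⁻¹ • rightBr Q n := rfl

theorem leftElt_eq (n : ℕ) : leftElt Q n = (denom Q n)⁻¹ • leftBr Q n := rfl

theorem map_proj_rightTerm (l m : ℕ) :
    Algebra.TensorProduct.map (proj Q) (proj Q) (rightTerm Q 0 1 l m) = rightTens Q l m := by
  simp [rightTerm, rightTens, rightBr, grp, x]

theorem rightBr_mul_x (n : ℕ) : rightBr Q n * x Q 1 =
    rightBr Q (n + 1) + (Q.p 0 1 * Q.p 1 1 ^ n) • (x Q 1 * rightBr Q n) := by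
  simp [rightBr, x, skewBracket_rightWord_succ]

theorem leftBr_succ (n : ℕ) : leftBr Q (n + 1) =
    x Q 1 * leftBr Q n - (Q.p 1 1 ^ n * Q.p 1 0) • (leftBr Q n * x Q 1) := by
  simp [leftBr, x, skewBracket_leftWord_succ]

theorem rightBr_mul_grp (n m : ℕ) : rightBr Q n * grp Q (Q.gr 0 * Q.gr 1 ^ m) =
    (Q.p 0 0 * Q.p 0 1 ^ m * (Q.p 1 0 * Q.p 1 1 ^ m) ^ n) •
      (grp Q (Q.gr 0 * Q.gr 1 ^ m) * rightBr Q n) := by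
  refine (map_mul (proj Q) _ _).symm.trans
    ((congrArg (proj Q) (skewBracket_mul_grp Q (rightWord 0 1 n) _)).trans ?_)
  rw [map_smul, map_mul (proj Q), wordChr_rightWord]
  refine congrArg (· • _) ?_
  simp only [map_mul, map_pow, Units.val_mul, Units.val_pow_eq_pow_val, QuantumVariables.p]

theorem x_pow_mul_grp (l m : ℕ) : x Q 1 ^ l * grp Q (Q.gr 0 * Q.gr 1 ^ m) =
    ((Q.p 1 0 * Q.p 1 1 ^ m) ^ l) • (grp Q (Q.gr 0 * Q.gr 1 ^ m) * x Q 1 ^ l) := by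
  have h := congrArg (proj Q) (QuantumBorel.x_pow_mul_grp Q 1 l (Q.gr 0 * Q.gr 1 ^ m))
  simp only [map_mul, map_smul, map_pow, Units.val_mul, Units.val_pow_eq_pow_val] at h
  simp only [map_mul, map_pow]
  exact h

/-! ### Products of the tensors occurring in the coproducts -/

theorem rightTens_mul_rightTens (l m l' m' : ℕ) : rightTens Q l m * rightTens Q l' m' =
    ((Q.p 1 0 * Q.p 1 1 ^ m') ^ l) •
      ((grp Q (Q.gr 0 ^ 2 * Q.gr 1 ^ (m + m')) * x Q 1 ^ (l + l')) ⊗ₜ[k]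
        (rightBr Q m * rightBr Q m')) := by
  have h : grp Q (Q.gr 0 * Q.gr 1 ^ m) * x Q 1 ^ l *
      (grp Q (Q.gr 0 * Q.gr 1 ^ m') * x Q 1 ^ l') =
      ((Q.p 1 0 * Q.p 1 1 ^ m') ^ l) •
        (grp Q (Q.gr 0 ^ 2 * Q.gr 1 ^ (m + m')) * x Q 1 ^ (l + l')) := by
    rw [mul_assoc, ← mul_assoc (x Q 1 ^ l), x_pow_mul_grp, smul_mul_assoc, mul_smul_comm,
      mul_assoc, ← pow_add, ← mul_assoc, ← map_mul, mul_mul_mul_comm, ← pow_add, ← pow_two]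
  rw [rightTens, rightTens, Algebra.TensorProduct.tmul_mul_tmul, h, TensorProduct.smul_tmul']

theorem tmul_one_mul_rightTens (n l m : ℕ) : (rightBr Q n ⊗ₜ[k] 1) * rightTens Q l m =
    (Q.p 0 0 * Q.p 0 1 ^ m * (Q.p 1 0 * Q.p 1 1 ^ m) ^ n) •
      ((grp Q (Q.gr 0 * Q.gr 1 ^ m) * (rightBr Q n * x Q 1 ^ l)) ⊗ₜ[k] rightBr Q m) := by
  rw [rightTens, Algebra.TensorProduct.tmul_mul_tmul, one_mul, ← mul_assoc, rightBr_mul_grp,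
    smul_mul_assoc, mul_assoc (grp Q _), TensorProduct.smul_tmul']

theorem rightTens_mul_tmul_one (n l m : ℕ) : rightTens Q l m * (rightBr Q n ⊗ₜ[k] 1) =
    (grp Q (Q.gr 0 * Q.gr 1 ^ m) * (x Q 1 ^ l * rightBr Q n)) ⊗ₜ[k] rightBr Q m := by
  rw [rightTens, Algebra.TensorProduct.tmul_mul_tmul, mul_one, mul_assoc]

/-! ### Normal forms with x_2 on the left -/

theorem rightBr_one_mul_x_sq : rightBr Q 1 * x Q 1 ^ 2 =
    rightBr Q 3 + (Q.p 0 1 * Q.p 1 1 * (1 + Q.p 1 1)) • (x Q 1 * rightBr Q 2)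
      + (Q.p 0 1 ^ 2 * Q.p 1 1 ^ 2) • (x Q 1 ^ 2 * rightBr Q 1) := by
  rw [pow_two (x Q 1), ← mul_assoc, rightBr_mul_x]
  simp only [add_mul, smul_mul_assoc, mul_assoc, rightBr_mul_x, mul_add, mul_smul_comm]
  module

theorem leftBr_one : leftBr Q 1 =
    (1 - Q.p 0 1 * Q.p 1 0) • (x Q 1 * rightBr Q 0) - Q.p 1 0 • rightBr Q 1 := by
  rw [leftBr_succ, leftBr_zero, ← rightBr_zero, rightBr_mul_x]
  module

theorem leftBr_two : leftBr Q 2 =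
    ((1 - Q.p 0 1 * Q.p 1 0) * (1 - Q.p 0 1 * Q.p 1 0 * Q.p 1 1)) • (x Q 1 ^ 2 * rightBr Q 0)
      - (Q.p 1 0 * (1 + Q.p 1 1) * (1 - Q.p 0 1 * Q.p 1 0 * Q.p 1 1)) • (x Q 1 * rightBr Q 1)
      + (Q.p 1 0 ^ 2 * Q.p 1 1) • rightBr Q 2 := by
  rw [leftBr_succ, leftBr_one]
  simp only [sub_mul, mul_sub, smul_mul_assoc, mul_assoc, rightBr_mul_x, mul_add, mul_smul_comm,
    pow_two (x Q 1)]
  module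

/-- Left and right bracketings span the same combinations: for n ≤ 3 the coefficient of x_2^(n-m)
[x_1 x_2^m] in [x_2^n x_1] is (-p_21)^m q^(m(m-1)/2) times the coefficient of the tensor with the
same m in the coproduct of [x_1 x_2^n]. -/
theorem leftBr_three : leftBr Q 3 =
    ((1 - Q.p 0 1 * Q.p 1 0) * (1 - Q.p 0 1 * Q.p 1 0 * Q.p 1 1)
        * (1 - Q.p 0 1 * Q.p 1 0 * Q.p 1 1 ^ 2)) • (x Q 1 ^ 3 * rightBr Q 0)
      - (Q.p 1 0 * (1 + Q.p 1 1 + Q.p 1 1 ^ 2) * (1 - Q.p 0 1 * Q.p 1 0 * Q.p 1 1)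
        * (1 - Q.p 0 1 * Q.p 1 0 * Q.p 1 1 ^ 2)) • (x Q 1 ^ 2 * rightBr Q 1)
      + (Q.p 1 0 ^ 2 * Q.p 1 1 * (1 + Q.p 1 1 + Q.p 1 1 ^ 2)
        * (1 - Q.p 0 1 * Q.p 1 0 * Q.p 1 1 ^ 2)) • (x Q 1 * rightBr Q 2)
      - (Q.p 1 0 ^ 3 * Q.p 1 1 ^ 3) • rightBr Q 3 := by
  rw [leftBr_succ, leftBr_two]
  simp only [sub_mul, mul_sub, add_mul, smul_mul_assoc, mul_assoc, rightBr_mul_x, mul_add,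
    mul_smul_comm, pow_succ' (x Q 1), pow_zero, mul_one]
  module

/-! ### Consequences of the Serre relation [x_1^2 x_2] = 0 -/

theorem rightBr_zero_mul_one : rightBr Q 0 * rightBr Q 1 =
    (Q.p 0 0 * Q.p 0 1) • (rightBr Q 1 * rightBr Q 0) := by
  -- The inner bracket [x_1, x_2] of the Serre word is also R_1, so the relation says that x_1 and
  -- R_1 commute up to p_11 p_12.
  have h : skewBracket Q (leftWord 0 1 1) = skewBracket Q (rightWord 0 1 1) := rfl
  have hl := proj_left Q
  rw [skewBracket_leftWord_succ, h, map_sub, map_smul, map_mul, map_mul, pow_one, sub_eq_zero] at hl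
  exact hl

theorem rightBr_zero_mul_two : rightBr Q 0 * rightBr Q 2 =
    (Q.p 0 0 * Q.p 0 1 - Q.p 0 1 * Q.p 1 1) • (rightBr Q 1 * rightBr Q 1)
      + (Q.p 0 0 * Q.p 0 1 ^ 2) • (rightBr Q 2 * rightBr Q 0) := by
  have h0 := rightBr_zero_mul_one Q
  -- Multiplying the previous relation by x_2 and moving x_2 to the left raises the degree by one;
  -- the two terms in x_2 R_1 R_0 then cancel.
  have h := congrArg (· * x Q 1) h0
  simp only [smul_mul_assoc, mul_assoc, rightBr_mul_x, mul_add, mul_smul_comm] at h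
  simp only [← mul_assoc, rightBr_mul_x, add_mul, smul_mul_assoc] at h
  simp only [mul_assoc, h0, mul_smul_comm] at h
  linear_combination (norm := module) h

/-! ### Coproducts in the quotient -/

theorem comul_rightBr_aux [Q.IsTypeG2] (n : ℕ) : Coalgebra.comul (R := k) (rightBr Q n) =
    Algebra.TensorProduct.map (proj Q) (proj Q)
      (SkewGroupAlgebra.comul Q (skewBracket Q (rightWord 0 1 n))) :=
  comul_proj Q _

theorem map_proj_rightWord_tmul_one (n : ℕ) : Algebra.TensorProduct.map (proj Q) (proj Q)
    (skewBracket Q (rightWord 0 1 n) ⊗ₜ[k] 1) = rightBr Q n ⊗ₜ[k] 1 := by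
  simp [rightBr]

theorem comul_rightBr_zero [Q.IsTypeG2] : Coalgebra.comul (R := k) (rightBr Q 0) =
    rightBr Q 0 ⊗ₜ[k] 1 + rightTens Q 0 0 := by
  simp only [comul_rightBr_aux, comul_rightWord_zero, map_add, map_proj_rightTerm,
    map_proj_rightWord_tmul_one]

theorem comul_rightBr_one [Q.IsTypeG2] : Coalgebra.comul (R := k) (rightBr Q 1) =
    rightBr Q 1 ⊗ₜ[k] 1 + rightTens Q 0 1 + (1 - Q.p 0 1 * Q.p 1 0) • rightTens Q 1 0 := by
  simp only [comul_rightBr_aux, comul_rightWord_one, map_add, map_smul, map_proj_rightTerm,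
    map_proj_rightWord_tmul_one]

theorem comul_rightBr_two [Q.IsTypeG2] : Coalgebra.comul (R := k) (rightBr Q 2) =
    rightBr Q 2 ⊗ₜ[k] 1 + rightTens Q 0 2
      + ((1 + Q.p 1 1) * (1 - Q.p 0 1 * Q.p 1 0 * Q.p 1 1)) • rightTens Q 1 1
      + ((1 - Q.p 0 1 * Q.p 1 0) * (1 - Q.p 0 1 * Q.p 1 0 * Q.p 1 1)) • rightTens Q 2 0 := by
  simp only [comul_rightBr_aux, comul_rightWord_two, map_add, map_smul, map_proj_rightTerm,
    map_proj_rightWord_tmul_one]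

theorem comul_rightBr_three [Q.IsTypeG2] : Coalgebra.comul (R := k) (rightBr Q 3) =
    rightBr Q 3 ⊗ₜ[k] 1 + rightTens Q 0 3
      + ((1 + Q.p 1 1 + Q.p 1 1 ^ 2) * (1 - Q.p 0 1 * Q.p 1 0 * Q.p 1 1 ^ 2)) • rightTens Q 1 2
      + ((1 + Q.p 1 1 + Q.p 1 1 ^ 2) * (1 - Q.p 0 1 * Q.p 1 0 * Q.p 1 1)
        * (1 - Q.p 0 1 * Q.p 1 0 * Q.p 1 1 ^ 2)) • rightTens Q 2 1
      + ((1 - Q.p 0 1 * Q.p 1 0) * (1 - Q.p 0 1 * Q.p 1 0 * Q.p 1 1)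
        * (1 - Q.p 0 1 * Q.p 1 0 * Q.p 1 1 ^ 2)) • rightTens Q 3 0 := by
  simp only [comul_rightBr_aux, comul_rightWord_three, map_add, map_smul, map_proj_rightTerm,
    map_proj_rightWord_tmul_one]

/-! ### Parameters and denominators in terms of p_21 and q -/

theorem p00_eq [Q.IsTypeG2] : Q.p 0 0 = Q.p 1 1 ^ 3 :=
  QuantumVariables.IsTypeG2.p11_eq.trans QuantumVariables.IsTypeG2.p12_p21

/-- With p_11 and p_12 eliminated, p_21 and q are the only parameters left, so scalar identities can
be settled as identities of rational functions. -/
theorem p01_eq [Q.IsTypeG2] : Q.p 0 1 = (Q.p 1 0)⁻¹ * (Q.p 1 1 ^ 3)⁻¹ := by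
  have h := p_right Q
  have h1 := p_ne_zero Q 1 0
  have h2 := p_ne_zero Q 1 1
  field_simp
  linear_combination h

theorem denom_zero : denom Q 0 = 1 := by
  simp [denom, qFactorial]

theorem denom_one [Q.IsTypeG2] : denom Q 1 =
    (Q.p 1 1 - 1) * (1 + Q.p 1 1 + Q.p 1 1 ^ 2) / Q.p 1 1 ^ 3 := by
  have hp := p_ne_zero Q 1 0
  have hq := p_ne_zero Q 1 1
  simp only [denom, qFactorial, qInt, Finset.prod_range_succ, Finset.prod_range_zero,
    Finset.sum_range_succ, Finset.sum_range_zero, p01_eq Q]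
  field_simp
  ring

theorem denom_two [Q.IsTypeG2] : denom Q 2 =
    (1 + Q.p 1 1) ^ 2 * (Q.p 1 1 - 1) ^ 2 * (1 + Q.p 1 1 + Q.p 1 1 ^ 2) / Q.p 1 1 ^ 5 := by
  have hp := p_ne_zero Q 1 0
  have hq := p_ne_zero Q 1 1
  simp only [denom, qFactorial, qInt, Finset.prod_range_succ, Finset.prod_range_zero,
    Finset.sum_range_succ, Finset.sum_range_zero, p01_eq Q]
  field_simp
  ring

theorem denom_three [Q.IsTypeG2] : denom Q 3 =
    (1 + Q.p 1 1) ^ 2 * (Q.p 1 1 - 1) ^ 3 * (1 + Q.p 1 1 + Q.p 1 1 ^ 2) ^ 2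
      / Q.p 1 1 ^ 6 := by
  have hp := p_ne_zero Q 1 0
  have hq := p_ne_zero Q 1 1
  simp only [denom, qFactorial, qInt, Finset.prod_range_succ, Finset.prod_range_zero,
    Finset.sum_range_succ, Finset.sum_range_zero, p01_eq Q]
  field_simp
  ring

end QuantumBorelG2

end QuantumBorel

theorem mainTheorem1 {k G : Type*} [Field k] [CommGroup G] (Q : QuantumVariables k G (Fin 2))
    [Q.IsTypeG2] :
    Coalgebra.comul (R := k) (QuantumBorelG2.topElt Q) =
      QuantumBorelG2.topElt Q ⊗ₜ[k] 1
        + QuantumBorelG2.grp Q (Q.gr 0 ^ 2 * Q.gr 1 ^ 3) ⊗ₜ[k] QuantumBorelG2.topElt Q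
        + ∑ n ∈ Finset.range 4, (QuantumBorelG2.grp Q (Q.gr 0 * Q.gr 1 ^ n)
            * QuantumBorelG2.leftElt Q (3 - n)) ⊗ₜ[k] QuantumBorelG2.rightElt Q n := by
  open QuantumBorelG2 in
  have hp := p_ne_zero Q 1 0
  have hq := p_ne_zero Q 1 1
  have ha : 1 + Q.p 1 1 ≠ 0 := fun e =>
    QuantumVariables.IsTypeG2.p22_ne (Q := Q) (by linear_combination e)
  have h3 : (Q.p 1 1 - 1) * (1 + Q.p 1 1 + Q.p 1 1 ^ 2) ≠ 0 := fun e =>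
    QuantumVariables.IsTypeG2.p22_cube_ne (Q := Q) (by linear_combination e)
  have hb := left_ne_zero_of_mul h3
  have hc := right_ne_zero_of_mul h3
  -- All denominators become products of p_21, q, q - 1, 1 + q and 1 + q + q^2, each known to be
  -- nonzero.
  have h1 : 1 - Q.p 1 1 ^ 3 = -((Q.p 1 1 - 1) * (1 + Q.p 1 1 + Q.p 1 1 ^ 2)) := by ring
  -- Both sides become linear combinations of g x_2^l R_a ⊗ R_b, g x_2^l ⊗ R_a R_b and R_a R_b ⊗ 1.
  -- Each x_1 is rewritten as R_0 so that it takes part in the straightening.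
  simp only [Finset.sum_range_succ, Finset.sum_range_zero, Nat.sub_zero, Nat.sub_self,
    Nat.reduceSub, zero_add, topElt, rightElt_eq, leftElt_eq, ← rightBr_zero, map_add, map_smul,
    Bialgebra.comul_mul, comul_rightBr_zero, comul_rightBr_one, comul_rightBr_two,
    comul_rightBr_three, add_mul, mul_add, smul_add, smul_mul_assoc, mul_smul_comm,
    rightTens_mul_rightTens, tmul_one_mul_rightTens, rightTens_mul_tmul_one,
    Algebra.TensorProduct.tmul_mul_tmul, mul_one, pow_zero, pow_one, one_mul, add_zero,
    leftBr_zero, leftBr_one, leftBr_two, leftBr_three,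
    rightBr_one_mul_x_sq, rightBr_mul_x, rightBr_zero_mul_one, rightBr_zero_mul_two,
    TensorProduct.add_tmul, TensorProduct.tmul_add, TensorProduct.tmul_smul, mul_sub, sub_mul,
    TensorProduct.sub_tmul, ← TensorProduct.smul_tmul', smul_sub, smul_smul, Nat.reduceAdd]
  simp only [denom_zero, denom_one, denom_two, denom_three, p00_eq, p01_eq, h1, qInt,
    Finset.sum_range_succ, Finset.sum_range_zero]
  generalize Q.p 1 1 = q at *
  generalize Q.p 1 0 = p at *
  -- Equality of coefficients monomial by monomial suffices, so no linear independence of the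
  -- monomials is needed.
  match_scalars <;> field_simp <;> ring
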